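/- Let $G$ be a locally compact, second countable (Hausdorff) topological group with a left Haar measure $m$, and suppose that $G$ is amenable, i.e. that $L^\infty(G,m)$ has a left-invariant mean. Let $G_0$ be the von Neumann kernel of $G$, i.e. the intersection of the kernels of all continuous homomorphisms from $G$ to the unitary group of a finite-dimensional complex Hilbert space, and assume that $G/G_0$ is not compact. Let $\Phi=(\Phi_N)_{N\in\mathbb{N}}$ be any left Følner sequence in $G$: each $\Phi_N$ is a compact set with $m(\Phi_N)>0$, and $m(\Phi_N\cap g\Phi_N)/m(\Phi_N)\to 1$ as $N\to\infty$, uniformly for $g$ in each compact subset of $G$. Let $\varepsilon>0$. Then there is a measurable set $E\subset G$ whose density $$d_\Phi(E)=\lim_{N\to\infty}\frac{m(E\cap\Phi_N)}{m(\Phi_N)}$$ exists and satisfies $d_\Phi(E)>1-\varepsilon$, and such that for no compact set $K\subset G$ does the set $KEK=\{k e k' : k,k'\in K,\ e\in E\}$ contain a set of measurable recurrence. Here a set $R\subset G$ is a set of measurable recurrence if for every compact $K\subset G$, every jointly measurable, measure-preserving action of $G$ on a separable probability space $(X,\mathscr{B},\mu)$, and every $A\in\mathscr{B}$ with $\mu(A)>0$,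 there is $g\in R\setminus K$ with $\mu(A\cap gA)>0$. -/

import Mathlib

open MeasureTheory Filter Topology
open scoped Pointwise ENNReal

universe u v

/-- A locally compact group `G` with left Haar measure `m` is amenable if `L^∞(G, m)` has a
left-invariant mean: a positive linear functional that takes the value `1` at the constant
function `1` and is invariant under all left translations. -/
def IsAmenableGroup (G : Type u) [Group G] [MeasurableSpace G] [MeasurableMul G]
    (m : Measure G) [m.IsMulLeftInvariant] : Prop :=
  ∃ M : Lp ℝ ∞ m →ₗ[ℝ] ℝ,
    (∀ f : Lp ℝ ∞ m, 0 ≤ f → 0 ≤ M f) ∧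
    M ((memLp_top_const (1 : ℝ)).toLp (fun _ : G => (1 : ℝ))) = 1 ∧
    ∀ (g : G) (f : Lp ℝ ∞ m),
      M (Lp.compMeasurePreserving (fun x : G => g⁻¹ * x) (measurePreserving_mul_left m g⁻¹) f) =
        M f

/-- The von Neumann kernel `G₀` of a topological group: the intersection of the kernels of all
finite-dimensional representations, that is, of all continuous homomorphisms of `G` to the unitary
group of a finite-dimensional complex Hilbert space (which may be taken to be `ℂⁿ`, the
unitary group then being `U(n)`). -/
def vonNeumannKernel (G : Type u) [Group G] [TopologicalSpace G] : Subgroup G :=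
  ⨅ (n : ℕ) (φ : G →* Matrix.unitaryGroup (Fin n) ℂ) (_ : Continuous φ), φ.ker

/-- A left Følner sequence: compact sets of positive measure such that
`m (Φ N ∩ g Φ N) / m (Φ N) → 1`, uniformly for `g` in each compact subset of `G`. -/
structure IsLeftFolner {G : Type u} [Group G] [TopologicalSpace G] [MeasurableSpace G]
    (m : Measure G) (Φ : ℕ → Set G) : Prop where
  isCompact : ∀ N, IsCompact (Φ N)
  measure_pos : ∀ N, 0 < m (Φ N)
  tendsto : ∀ K : Set G, IsCompact K →
    TendstoUniformlyOn (fun N g => m.real (Φ N ∩ g • Φ N) / m.real (Φ N)) (fun _ => 1) atTop K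

/-- The density of `E` with respect to `Φ` exists and equals `d`. -/
def HasDensity {G : Type u} [MeasurableSpace G] (m : Measure G) (Φ : ℕ → Set G) (E : Set G)
    (d : ℝ) : Prop :=
  Tendsto (fun N => m.real (E ∩ Φ N) / m.real (Φ N)) atTop (𝓝 d)

/-- `R ⊆ G` is a set of measurable recurrence if for every compact `K ⊆ G`, every jointly
measurable, measure-preserving action of `G` on a separable probability space `(X, μ)` and every
non-null measurable `A ⊆ X`, there is `g ∈ R \ K` with `μ (A ∩ g A) > 0`. -/
def IsMeasurableRecurrenceSet {G : Type u} [Group G] [TopologicalSpace G] [MeasurableSpace G]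
    (R : Set G) : Prop :=
  ∀ K : Set G, IsCompact K →
    ∀ (X : Type v) [MeasurableSpace X] (μ : Measure X) [IsProbabilityMeasure μ]
      [MeasureTheory.IsSeparable μ] [MulAction G X] [MeasurableSMul₂ G X]
      [SMulInvariantMeasure G X μ] (A : Set X),
      MeasurableSet A → μ A ≠ 0 → ∃ g ∈ R \ K, 0 < μ (A ∩ g • A)

/-!
The set `E` is the complement of a countable union of Bohr-type sets, each one cut off near the
start of the Følner sequence.

Let `G₀` be the von Neumann kernel. As `G` is second countable, countably many finite-dimensional
unitary representations already have intersection of kernels `G₀`; together they form a continuous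
homomorphism `ψ` with dense range and kernel `G₀` into a compact second countable group `H`
(`exists_hom_compact_ker_eq_vonNeumannKernel`). Let `μ` be the Haar probability measure of `H`.

* For every compact `K ⊆ G`, the image `ψ K` is `μ`-null (`haar_image_eq_zero`). Otherwise, by
  Steinhaus' theorem, the range of `ψ` contains a neighbourhood of `1`, so `ψ` is onto; by the
  open mapping theorem `G ⧸ G₀` is then homeomorphic to `H`, hence compact.
* The images under `ψ` of the normalized restrictions of `m` to the Følner sets converge weakly to
  `μ` (`tendsto_integral_map_cond`), so that `ψ⁻¹ S` has density `μ S` whenever the frontier of `S`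
  is null, and compact subsets of `G` have density `0`.
* The rotation action of `G` on `(H, μ)` shows that every set of measurable recurrence meets
  `ψ⁻¹ (W / W)` outside any given compact set, for each nonempty open `W ⊆ H`
  (`IsMeasurableRecurrenceSet.exists_mem_div`).

Let `L j` be a compact exhaustion of `G`. The compact set `ψ (L j) * ψ (L j)` is null, so it lies
in an open `U j` with null frontier and with `μ (U j)` less than `η j`, where `∑ η j = ε / 2`. Let
`F j` be a finite union of Følner sets containing all those in which `ψ⁻¹ (U j)` takes a
proportion of at least `η j`, and let `E` be the complement of `⋃ j, ψ⁻¹ (U j) \ F j`. The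
cut-off makes the proportions of these sets at most `η j` in *every* Følner set; this allows the
limit and the sum over `j` to be interchanged, and gives `E` a density of at least `1 - ε / 2`. If
a set of measurable recurrence were contained in `K * E * K`, with `K⁻¹ ⊆ L j`, take an open `W ∋
1` such that `ψ (L j) * (W / W) * ψ (L j) ⊆ U j`. Recurrence outside `K * F j * K` gives `k * e *
k'` in `ψ⁻¹ (W / W)` with `e ∈ E \ F j`, and then `e ∈ ψ⁻¹ (U j)`, a contradiction.
-/

/-! ### The homomorphism to a compact group with kernel the von Neumann kernel -/

theorem compactSpace_unitaryGroup (n : ℕ) : CompactSpace (Matrix.unitaryGroup (Fin n) ℂ) := by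
  refine isCompact_iff_compactSpace.mp (IsCompact.of_isClosed_subset
    (isCompact_univ_pi fun _ : Fin n => isCompact_univ_pi fun _ : Fin n =>
      isCompact_closedBall (0 : ℂ) 1) ?_ fun M hM => ?_)
  · have : {M : Matrix (Fin n) (Fin n) ℂ | star M * M = 1 ∧ M * star M = 1} =
        (Matrix.unitaryGroup (Fin n) ℂ : Set (Matrix (Fin n) (Fin n) ℂ)) := by
      ext M; exact Unitary.mem_iff.symm
    rw [← this]
    exact (isClosed_eq (by fun_prop) continuous_const).inter
      (isClosed_eq (by fun_prop) continuous_const)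
  · intro i _ j _
    simpa using entry_norm_bound_of_unitary hM i j

/-- The von Neumann kernel of a second countable group is the kernel of a single homomorphism with
dense range into a compact second countable group: the closure of the image of `G` in a countable
product of unitary groups. The compact group lives in `Type`, whatever the universe of `G`. -/
theorem exists_hom_compact_ker_eq_vonNeumannKernel (G : Type u) [Group G] [TopologicalSpace G]
    [SecondCountableTopology G] :
    ∃ (H : Type) (_ : Group H) (_ : TopologicalSpace H) (_ : IsTopologicalGroup H)
      (_ : CompactSpace H) (_ : T2Space H) (_ : SecondCountableTopology H) (ψ : G →* H),
      Continuous ψ ∧ DenseRange ψ ∧ ψ.ker = vonNeumannKernel G := by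
  classical
  let I := Σ n : ℕ, {φ : G →* Matrix.unitaryGroup (Fin n) ℂ // Continuous φ}
  -- The complement of the von Neumann kernel is a union of open sets, one for each representation,
  -- and by the Lindelöf property countably many of them suffice.
  obtain ⟨T, hTc, hT⟩ := TopologicalSpace.isOpen_iUnion_countable
    (fun i : I => {g : G | i.2.1 g ≠ 1})
    (fun i => isOpen_ne_fun i.2.2 continuous_const)
  -- The trivial representation makes the countable family nonempty, so it is a sequence.
  let i₀ : I := ⟨0, 1, continuous_const⟩
  obtain ⟨f, hf⟩ := (hTc.insert i₀).exists_eq_range (Set.insert_nonempty _ _)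
  let P := ∀ k : ℕ, Matrix.unitaryGroup (Fin (f k).1) ℂ
  have : ∀ n : ℕ, CompactSpace (Matrix.unitaryGroup (Fin n) ℂ) := compactSpace_unitaryGroup
  have : ∀ n : ℕ, IsTopologicalGroup (Matrix.unitaryGroup (Fin n) ℂ) :=
    fun n => inferInstanceAs (IsTopologicalGroup (unitary (Matrix (Fin n) (Fin n) ℂ)))
  have : ∀ n : ℕ, SecondCountableTopology (Matrix (Fin n) (Fin n) ℂ) :=
    fun n => inferInstanceAs (SecondCountableTopology (Fin n → Fin n → ℂ))
  have : ∀ n : ℕ, SecondCountableTopology (Matrix.unitaryGroup (Fin n) ℂ) :=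
    fun n => TopologicalSpace.Subtype.secondCountableTopology _
  let ψ₀ : G →* P := MonoidHom.mk' (fun g k => (f k).2.1 g) fun a b =>
    funext fun _ => map_mul _ a b
  have hψ₀ : Continuous ψ₀ := continuous_pi fun k => (f k).2.2
  let H : Subgroup P := ψ₀.range.topologicalClosure
  have hH : IsClosed (H : Set P) := Subgroup.isClosed_topologicalClosure _
  have hmem : ∀ g, ψ₀ g ∈ H := fun g => Subgroup.le_topologicalClosure _ ⟨g, rfl⟩
  refine ⟨H, inferInstance, inferInstance, inferInstance,
    isCompact_iff_compactSpace.mp hH.isCompact, inferInstance,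
    TopologicalSpace.Subtype.secondCountableTopology _,
    ψ₀.codRestrict H hmem, hψ₀.subtype_mk hmem, ?_, ?_⟩
  · intro x
    rw [closure_subtype, ← Set.range_comp]
    exact x.2
  · ext g
    have key : g ∈ ⋃ i ∈ T, {g : G | i.2.1 g ≠ 1} ↔ g ∈ ⋃ i : I, {g : G | i.2.1 g ≠ 1} := by
      rw [hT]
    rw [MonoidHom.mem_ker, vonNeumannKernel]
    simp only [Subgroup.mem_iInf, MonoidHom.mem_ker]
    constructor
    · intro h n φ hφ
      by_contra hne
      have : g ∈ ⋃ i ∈ T, {g : G | i.2.1 g ≠ 1} :=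
        key.2 (Set.mem_iUnion.2 ⟨⟨n, φ, hφ⟩, hne⟩)
      obtain ⟨i, hi, hg⟩ := Set.mem_iUnion₂.1 this
      obtain ⟨k, rfl⟩ : i ∈ Set.range f := hf ▸ Set.mem_insert_of_mem _ hi
      exact hg (congrFun (congrArg Subtype.val h) k)
    · intro h
      exact Subtype.ext (funext fun k => h _ _ (f k).2.2)

/-! ### Images of compact sets are null -/

section

variable {G : Type u} [Group G] [TopologicalSpace G] [IsTopologicalGroup G]
  {H : Type*} [Group H] [TopologicalSpace H] [IsTopologicalGroup H] [CompactSpace H] [T2Space H]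

theorem compactSpace_quotient_ker_of_surjective [SigmaCompactSpace G] {ψ : G →* H}
    (hψ : Continuous ψ) (hs : Function.Surjective ψ) : CompactSpace (G ⧸ ψ.ker) := by
  have hopen : IsOpenMap ψ := ψ.isOpenMap_of_sigmaCompact hs hψ
  let e := QuotientGroup.quotientKerEquivOfSurjective ψ hs
  have hc : Continuous e := continuous_quot_lift _ hψ
  have ho : IsOpenMap e := by
    intro s hs'
    have : e '' s = ψ '' ((QuotientGroup.mk : G → G ⧸ ψ.ker) ⁻¹' s) := by
      conv_lhs => rw [← Set.image_preimage_eq s (QuotientGroup.mk_surjective (s := ψ.ker))]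
      rw [Set.image_image]
      rfl
    rw [this]
    exact hopen _ (hs'.preimage QuotientGroup.continuous_mk)
  exact (e.toEquiv.toHomeomorphOfContinuousOpen hc ho).symm.compactSpace

variable [MeasurableSpace H] [BorelSpace H]

/-- If `G ⧸ ker ψ` is not compact, then the images of compact sets under `ψ` are null: a compact
set of positive measure would, by Steinhaus' theorem, make the range of `ψ` open, hence all
of `H`. -/
theorem haar_image_eq_zero [SigmaCompactSpace G] [SecondCountableTopology H] (μ : Measure H)
    [μ.IsHaarMeasure] {ψ : G →* H} (hψ : Continuous ψ)
    (hd : DenseRange ψ) (hker : ¬ CompactSpace (G ⧸ ψ.ker)) {K : Set G} (hK : IsCompact K) :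
    μ (ψ '' K) = 0 := by
  by_contra hne
  refine hker (compactSpace_quotient_ker_of_surjective hψ ?_)
  have hc : IsCompact (ψ '' K) := hK.image hψ
  have h1 : ψ '' K / ψ '' K ∈ 𝓝 (1 : H) :=
    Measure.div_mem_nhds_one_of_haar_pos_ne_top μ _ hc.isClosed.measurableSet
      (pos_iff_ne_zero.2 hne) hc.measure_lt_top.ne
  have h2 : (ψ.range : Set H) ∈ 𝓝 (1 : H) := by
    refine mem_of_superset h1 ?_
    rintro _ ⟨_, ⟨a, -, rfl⟩, _, ⟨b, -, rfl⟩, rfl⟩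
    exact ⟨a / b, map_div _ _ _⟩
  have h3 := Subgroup.isClosed_of_isOpen _ (Subgroup.isOpen_of_mem_nhds _ h2)
  rw [MonoidHom.coe_range] at h3
  exact Set.range_eq_univ.1 (h3.closure_eq ▸ hd.closure_range)

/-- Compact groups are unimodular: right translates of the Haar probability measure are again Haar
probability measures. -/
theorem isMulRightInvariant_of_compactSpace [SecondCountableTopology H] (μ : Measure H)
    [μ.IsHaarMeasure] [IsProbabilityMeasure μ] : μ.IsMulRightInvariant where
  map_mul_right_eq_self g :=
    have : IsProbabilityMeasure (μ.map (· * g)) :=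
      Measure.isProbabilityMeasure_map (measurable_mul_const g).aemeasurable
    Measure.isHaarMeasure_eq_of_isProbabilityMeasure _ _

end

/-! ### Equidistribution of Følner sets in the compact group -/

namespace IsLeftFolner

section

variable {G : Type u} [Group G] [TopologicalSpace G] [MeasurableSpace G] {m : Measure G}
  {Φ : ℕ → Set G}

theorem measurableSet [T2Space G] [OpensMeasurableSpace G] (hΦ : IsLeftFolner m Φ) (N : ℕ) :
    MeasurableSet (Φ N) :=
  (hΦ.isCompact N).isClosed.measurableSet

theorem measure_ne_top [IsFiniteMeasureOnCompacts m] (hΦ : IsLeftFolner m Φ) (N : ℕ) :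
    m (Φ N) ≠ ∞ :=
  (hΦ.isCompact N).measure_lt_top.ne

theorem measureReal_pos [IsFiniteMeasureOnCompacts m] (hΦ : IsLeftFolner m Φ) (N : ℕ) :
    0 < m.real (Φ N) :=
  ENNReal.toReal_pos (hΦ.measure_pos N).ne' (hΦ.measure_ne_top N)

theorem tendsto_measureReal_inter_smul (hΦ : IsLeftFolner m Φ) (g : G) :
    Tendsto (fun N => m.real (Φ N ∩ g • Φ N) / m.real (Φ N)) atTop (𝓝 1) :=
  (hΦ.tendsto {g} isCompact_singleton).tendsto_at (Set.mem_singleton g)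

theorem isProbabilityMeasure_cond [IsFiniteMeasureOnCompacts m] (hΦ : IsLeftFolner m Φ) (N : ℕ) :
    IsProbabilityMeasure (ProbabilityTheory.cond m (Φ N)) :=
  ProbabilityTheory.cond_isProbabilityMeasure_of_finite (hΦ.measure_pos N).ne'
    (hΦ.measure_ne_top N)

end

section

variable {G : Type u} [Group G] [TopologicalSpace G] [IsTopologicalGroup G] [T2Space G]
  [MeasurableSpace G] [BorelSpace G] {m : Measure G} [m.IsHaarMeasure] {Φ : ℕ → Set G}

/-- Translating a bounded function changes its integral over a Følner set by at most the sup norm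
times the measure of the symmetric difference of the Følner set and its translate. -/
theorem abs_setIntegral_mul_left_sub_le (hΦ : IsLeftFolner m Φ) {F : G → ℝ} (hF : Measurable F)
    {C : ℝ} (hC : ∀ x, |F x| ≤ C) (g : G) (N : ℕ) :
    |∫ x in Φ N, F (g * x) ∂m - ∫ x in Φ N, F x ∂m| ≤
      2 * C * (m.real (Φ N) - m.real (Φ N ∩ g • Φ N)) := by
  have hm := hΦ.measurableSet N
  have hgm : MeasurableSet (g • Φ N) := hm.const_smul g
  have hreal : m.real (g • Φ N) = m.real (Φ N) := by
    rw [Measure.real, measure_smul, Measure.real]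
  have hgtop : m (g • Φ N) ≠ ∞ := by rw [measure_smul]; exact hΦ.measure_ne_top N
  have hpre : (fun x => g * x) ⁻¹' (g • Φ N) = Φ N := by
    ext x; exact Set.smul_mem_smul_set_iff
  have hint : ∀ s : Set G, m s ≠ ∞ → IntegrableOn F s m := fun s hs =>
    Measure.integrableOn_of_bounded (M := C) hs hF.aestronglyMeasurable
      (ae_of_all _ hC)
  have h1 : ∫ x in Φ N, F (g * x) ∂m = ∫ x in g • Φ N, F x ∂m := by
    have := (measurePreserving_mul_left m g).setIntegral_preimage_emb
      (measurableEmbedding_mulLeft g) F (g • Φ N)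
    rwa [hpre] at this
  have h2 := integral_inter_add_sdiff (s := g • Φ N) hm (hint _ hgtop)
  have h3 := integral_inter_add_sdiff (s := Φ N) hgm (hint _ (hΦ.measure_ne_top N))
  have h4 := measureReal_inter_add_sdiff (s := g • Φ N) hm hgtop
  have h5 := measureReal_inter_add_sdiff (s := Φ N) hgm (hΦ.measure_ne_top N)
  have hle : ∀ s : Set G, m s ≠ ∞ → |∫ x in s, F x ∂m| ≤ C * m.real s := fun s hs =>
    norm_setIntegral_le_of_norm_le_const (f := F) hs.lt_top fun x _ => hC x
  have h6 := hle (g • Φ N \ Φ N) (measure_ne_top_of_subset Set.sdiff_subset hgtop)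
  have h7 := hle (Φ N \ g • Φ N)
    (measure_ne_top_of_subset Set.sdiff_subset (hΦ.measure_ne_top N))
  rw [Set.inter_comm] at h2 h4
  rw [h1, ← h2, ← h3, add_sub_add_left_eq_sub]
  refine (abs_sub _ _).trans ((add_le_add h6 h7).trans (le_of_eq ?_))
  rw [← mul_add, show m.real (g • Φ N \ Φ N) = m.real (Φ N) - m.real (Φ N ∩ g • Φ N) by linarith,
    show m.real (Φ N \ g • Φ N) = m.real (Φ N) - m.real (Φ N ∩ g • Φ N) by linarith]
  ring

end

end IsLeftFolner

section

variable {G : Type u} [Group G] [TopologicalSpace G] [IsTopologicalGroup G] [T2Space G]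
  [MeasurableSpace G] [BorelSpace G] {m : Measure G} [m.IsHaarMeasure] {Φ : ℕ → Set G}
  {H : Type*} [Group H] [TopologicalSpace H] [IsTopologicalGroup H] [CompactSpace H]
  [MeasurableSpace H] [BorelSpace H] {ψ : G →* H}

/-- Averages over Følner sets are asymptotically invariant under translation by elements of the
range of `ψ`. -/
theorem tendsto_integral_map_cond_mul_left_sub_of_mem_range (hΦ : IsLeftFolner m Φ)
    (hψ : Continuous ψ) (f : C(H, ℝ)) (g : G) :
    Tendsto (fun N => ∫ y, f (ψ g * y) ∂((ProbabilityTheory.cond m (Φ N)).map ψ) -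
      ∫ y, f y ∂((ProbabilityTheory.cond m (Φ N)).map ψ)) atTop (𝓝 0) := by
  have hsq : Tendsto (fun N => 2 * ‖f‖ * (1 - m.real (Φ N ∩ g • Φ N) / m.real (Φ N)))
      atTop (𝓝 0) := by
    have := ((hΦ.tendsto_measureReal_inter_smul g).const_sub 1).const_mul (2 * ‖f‖)
    simpa using this
  refine squeeze_zero_norm (fun N => ?_) hsq
  have hpos := hΦ.measureReal_pos N
  have hcond : ∀ F : G → ℝ, ∫ x, F x ∂(ProbabilityTheory.cond m (Φ N)) =
      (m.real (Φ N))⁻¹ * ∫ x in Φ N, F x ∂m := fun F => by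
    rw [ProbabilityTheory.cond, integral_smul_measure, ENNReal.toReal_inv, smul_eq_mul]; rfl
  have hcf : Continuous f := f.continuous
  rw [integral_map hψ.measurable.aemeasurable
      (show Continuous fun y => f (ψ g * y) by fun_prop).measurable.aestronglyMeasurable,
    integral_map hψ.measurable.aemeasurable hcf.measurable.aestronglyMeasurable,
    hcond, hcond, ← mul_sub, norm_mul, norm_inv, Real.norm_eq_abs, Real.norm_eq_abs,
    abs_of_pos hpos, inv_mul_le_iff₀ hpos]
  have := hΦ.abs_setIntegral_mul_left_sub_le (F := fun x => f (ψ x))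
    (hcf.comp hψ).measurable (C := ‖f‖) (fun x => f.norm_coe_le_norm _) g N
  simp only [map_mul] at this
  refine this.trans (le_of_eq ?_)
  field_simp

/-- Averages over Følner sets are asymptotically invariant under translation by all elements of
`H`: `h ↦ f (h * ·)` is continuous for the sup norm, and the range of `ψ` is dense. -/
theorem tendsto_integral_map_cond_mul_left_sub (hΦ : IsLeftFolner m Φ)
    (hψ : Continuous ψ) (hd : DenseRange ψ) (f : C(H, ℝ)) (h : H) :
    Tendsto (fun N => ∫ y, f (h * y) ∂((ProbabilityTheory.cond m (Φ N)).map ψ) -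
      ∫ y, f y ∂((ProbabilityTheory.cond m (Φ N)).map ψ)) atTop (𝓝 0) := by
  -- Currying gives the continuity of `h ↦ f (h * ·)` with values in `C(H, ℝ)`.
  let T : C(H, C(H, ℝ)) := ContinuousMap.curry ⟨fun p : H × H => f (p.1 * p.2), by fun_prop⟩
  have hT : ∀ a y, T a y = f (a * y) := fun _ _ => rfl
  rw [Metric.tendsto_atTop]
  intro ε hε
  obtain ⟨g, hg⟩ := hd.exists_mem_open
    (T.continuous.isOpen_preimage _ (Metric.isOpen_ball (x := T h) (ε := ε / 2)))
    ⟨h, Metric.mem_ball_self (half_pos hε)⟩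
  obtain ⟨N₀, hN₀⟩ := Metric.tendsto_atTop.1
    (tendsto_integral_map_cond_mul_left_sub_of_mem_range hΦ hψ f g) (ε / 2) (half_pos hε)
  refine ⟨N₀, fun N hN => ?_⟩
  have h1 := hN₀ N hN
  have := hΦ.isProbabilityMeasure_cond N
  have : IsProbabilityMeasure ((ProbabilityTheory.cond m (Φ N)).map ψ) :=
    Measure.isProbabilityMeasure_map hψ.measurable.aemeasurable
  set P := (ProbabilityTheory.cond m (Φ N)).map ψ
  have hint : ∀ F : C(H, ℝ), Integrable F P := fun F =>
    Integrable.of_bound F.continuous.measurable.aestronglyMeasurable ‖F‖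
      (ae_of_all _ F.norm_coe_le_norm)
  have h2 : |∫ y, f (h * y) ∂P - ∫ y, f (ψ g * y) ∂P| ≤ ε / 2 := by
    simp only [← hT]
    rw [← integral_sub (hint _) (hint _)]
    have := norm_integral_le_of_norm_le_const (μ := P) (f := fun y => T h y - T (ψ g) y)
      (C := ε / 2) (ae_of_all _ fun y => ?_)
    · simpa using this
    · rw [← dist_eq_norm, dist_comm]
      exact (ContinuousMap.dist_apply_le_dist y).trans (Metric.mem_ball.1 hg).le
  rw [dist_zero_right, Real.norm_eq_abs] at h1 ⊢
  calc _ ≤ |∫ y, f (h * y) ∂P - ∫ y, f (ψ g * y) ∂P| +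
        |∫ y, f (ψ g * y) ∂P - ∫ y, f y ∂P| := abs_sub_le _ _ _
    _ < ε / 2 + ε / 2 := add_lt_add_of_le_of_lt h2 h1
    _ = ε := add_halves ε

/-- The Følner averages converge weakly to Haar measure: integrate the asymptotic invariance over
all `h`, and use Fubini's theorem and right invariance of `μ` to evaluate the integral. -/
theorem tendsto_integral_map_cond [SecondCountableTopology H] [T2Space H]
    (hΦ : IsLeftFolner m Φ) (hψ : Continuous ψ)
    (hd : DenseRange ψ) (μ : Measure H) [μ.IsHaarMeasure] [IsProbabilityMeasure μ] (f : C(H, ℝ)) :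
    Tendsto (fun N => ∫ y, f y ∂((ProbabilityTheory.cond m (Φ N)).map ψ)) atTop
      (𝓝 (∫ y, f y ∂μ)) := by
  have := isMulRightInvariant_of_compactSpace μ
  have hP : ∀ N, IsProbabilityMeasure ((ProbabilityTheory.cond m (Φ N)).map ψ) := fun N =>
    have := hΦ.isProbabilityMeasure_cond N
    Measure.isProbabilityMeasure_map hψ.measurable.aemeasurable
  set P := fun N => (ProbabilityTheory.cond m (Φ N)).map ψ
  let k : C(H × H, ℝ) := ⟨fun p : H × H => f (p.1 * p.2), by fun_prop⟩
  have hk : ∀ a y, k (a, y) = f (a * y) := fun _ _ => rfl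
  have hkint : ∀ ν : Measure (H × H), IsFiniteMeasure ν → Integrable k ν := fun ν _ =>
    Integrable.of_bound k.continuous.measurable.aestronglyMeasurable ‖k‖
      (ae_of_all _ k.norm_coe_le_norm)
  have hint1 : ∀ N, Integrable (fun h => ∫ y, f (h * y) ∂(P N)) μ := fun N =>
    (hkint (μ.prod (P N)) inferInstance).integral_prod_left
  have hswap : ∀ N, ∫ h, ∫ y, f (h * y) ∂(P N) ∂μ = ∫ y, f y ∂μ := fun N => by
    rw [integral_integral_swap (hkint (μ.prod (P N)) inferInstance)]
    simp [integral_mul_right_eq_self]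
  have hdct : Tendsto (fun N => ∫ h, (∫ y, f (h * y) ∂(P N) - ∫ y, f y ∂(P N)) ∂μ) atTop
      (𝓝 (∫ _, (0 : ℝ) ∂μ)) := by
    refine tendsto_integral_of_dominated_convergence (fun _ => ‖f‖ + ‖f‖)
      (fun N => ((hint1 N).sub (integrable_const _)).aestronglyMeasurable) (integrable_const _)
      (fun N => ae_of_all _ fun h => ?_)
      (ae_of_all _ fun h => tendsto_integral_map_cond_mul_left_sub hΦ hψ hd f h)
    refine (norm_sub_le _ _).trans (add_le_add ?_ ?_)
    · simpa using norm_integral_le_of_norm_le_const (μ := P N) (f := fun y => f (h * y))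
        (ae_of_all _ fun y => f.norm_coe_le_norm _)
    · simpa using norm_integral_le_of_norm_le_const (μ := P N) (f := fun y => f y)
        (ae_of_all _ fun y => f.norm_coe_le_norm _)
  have hsub : ∀ N, ∫ h, (∫ y, f (h * y) ∂(P N) - ∫ y, f y ∂(P N)) ∂μ =
      ∫ y, f y ∂μ - ∫ y, f y ∂(P N) := fun N => by
    rw [integral_sub (hint1 N) (integrable_const _), hswap]
    simp
  simp only [hsub, integral_zero] at hdct
  simpa using hdct.const_sub (∫ y, f y ∂μ)

/-- Weak convergence of the Følner averages, tested on sets with null frontier (portmanteau). -/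
theorem hasDensity_preimage_of_null_frontier [SecondCountableTopology H] [T2Space H]
    (hΦ : IsLeftFolner m Φ) (hψ : Continuous ψ)
    (hd : DenseRange ψ) (μ : Measure H) [μ.IsHaarMeasure] [IsProbabilityMeasure μ] {S : Set H}
    (hSm : MeasurableSet S) (hS : μ (frontier S) = 0) :
    HasDensity m Φ (ψ ⁻¹' S) (μ.real S) := by
  have hP : ∀ N, IsProbabilityMeasure ((ProbabilityTheory.cond m (Φ N)).map ψ) := fun N =>
    have := hΦ.isProbabilityMeasure_cond N
    Measure.isProbabilityMeasure_map hψ.measurable.aemeasurable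
  let P : ℕ → ProbabilityMeasure H := fun N => ⟨_, hP N⟩
  let μ' : ProbabilityMeasure H := ⟨μ, inferInstance⟩
  let _ := TopologicalSpace.metrizableSpaceMetric H
  have hlim : Tendsto P atTop (𝓝 μ') :=
    ProbabilityMeasure.tendsto_iff_forall_integral_tendsto.2 fun f =>
      tendsto_integral_map_cond hΦ hψ hd μ f.toContinuousMap
  have h := ProbabilityMeasure.tendsto_measure_of_null_frontier_of_tendsto' hlim (E := S) hS
  have h' := (ENNReal.tendsto_toReal (measure_ne_top μ S)).comp h
  refine h'.congr fun N => ?_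
  change (((ProbabilityTheory.cond m (Φ N)).map ψ) S).toReal = _
  rw [Measure.map_apply hψ.measurable hSm, ProbabilityTheory.cond_apply (hΦ.measurableSet N),
    ENNReal.toReal_mul, ENNReal.toReal_inv, Set.inter_comm, div_eq_inv_mul]
  rfl

end

/-! ### Calculus of densities -/

section

variable {G : Type u} [MeasurableSpace G] {m : Measure G} {Φ : ℕ → Set G}

theorem HasDensity.of_symmDiff_subset (hfin : ∀ N, m (Φ N) ≠ ∞) {A B F : Set G} {d : ℝ}
    (hA : HasDensity m Φ A d) (hF : HasDensity m Φ F 0) (hAB : A ⊆ B ∪ F) (hBA : B ⊆ A ∪ F) :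
    HasDensity m Φ B d := by
  have hle : ∀ {S T : Set G} (N : ℕ), S ⊆ T ∪ F →
      m.real (S ∩ Φ N) ≤ m.real (T ∩ Φ N) + m.real (F ∩ Φ N) := fun {S T} N h => by
    refine (measureReal_mono ?_ ?_).trans (measureReal_union_le _ _)
    · rw [← Set.union_inter_distrib_right]
      exact Set.inter_subset_inter_left _ h
    · rw [← Set.union_inter_distrib_right]
      exact measure_ne_top_of_subset Set.inter_subset_right (hfin N)
  have hlow := hA.sub hF
  have hupp := hA.add hF
  rw [sub_zero] at hlow
  rw [add_zero] at hupp
  refine tendsto_of_tendsto_of_tendsto_of_le_of_le hlow hupp (fun N => ?_) fun N => ?_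
  · rw [← sub_div]
    exact div_le_div_of_nonneg_right (by linarith [hle N hAB]) measureReal_nonneg
  · rw [← add_div]
    exact div_le_div_of_nonneg_right (hle N hBA) measureReal_nonneg

theorem HasDensity.zero_of_subset (hfin : ∀ N, m (Φ N) ≠ ∞) {A B : Set G}
    (hB : HasDensity m Φ B 0) (hAB : A ⊆ B) : HasDensity m Φ A 0 :=
  hB.of_symmDiff_subset hfin hB Set.subset_union_right (hAB.trans Set.subset_union_left)

theorem HasDensity.compl (hpos : ∀ N, 0 < m.real (Φ N)) {A : Set G} {d : ℝ}
    (hAm : MeasurableSet A) (hA : HasDensity m Φ A d) : HasDensity m Φ Aᶜ (1 - d) := by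
  refine (hA.const_sub 1).congr fun N => ?_
  have hfin : m (Φ N) ≠ ∞ := fun h => by simpa [Measure.real, h] using hpos N
  have h := measureReal_inter_add_sdiff (s := Φ N) hAm hfin
  rw [Set.sdiff_eq, Set.inter_comm, Set.inter_comm (Φ N)] at h
  rw [← h, eq_div_iff (h ▸ (hpos N).ne'), sub_mul, div_mul_cancel₀ _ (h ▸ (hpos N).ne')]
  ring

/-- Countable additivity of density for disjoint sets whose proportions in all `Φ N` are bounded
by a summable sequence. -/
theorem HasDensity.iUnion (hfin : ∀ N, m (Φ N) ≠ ∞)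
    {A : ℕ → Set G} {a η : ℕ → ℝ}
    (hAm : ∀ j, MeasurableSet (A j)) (hdisj : Pairwise (Function.onFun Disjoint A))
    (hA : ∀ j, HasDensity m Φ (A j) (a j))
    (hη : ∀ j N, m.real (A j ∩ Φ N) / m.real (Φ N) ≤ η j) (hsum : Summable η) :
    HasDensity m Φ (⋃ j, A j) (∑' j, a j) := by
  refine (tendsto_tsum_of_dominated_convergence hsum hA
    (Eventually.of_forall fun N j => ?_)).congr fun N => ?_
  · rw [Real.norm_of_nonneg (div_nonneg measureReal_nonneg measureReal_nonneg)]
    exact hη j N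
  · rw [tsum_div_const]
    congr 1
    have : Fact (m (Φ N) < ∞) := ⟨(hfin N).lt_top⟩
    have h := measure_iUnion (μ := m.restrict (Φ N)) hdisj hAm
    rw [Measure.restrict_apply (MeasurableSet.iUnion hAm)] at h
    simp_rw [Measure.restrict_apply (hAm _)] at h
    rw [Measure.real, h, ENNReal.tsum_toReal_eq]
    · rfl
    · exact fun j => measure_ne_top_of_subset Set.inter_subset_right (hfin N)

end

/-! ### Open sets with null frontier and neighbourhoods of compact sets -/

theorem measure_frontier_disjointed_eq_zero {X : Type*} [TopologicalSpace X] [MeasurableSpace X]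
    {μ : Measure X} {U : ℕ → Set X} (hU : ∀ j, μ (frontier (U j)) = 0) (j : ℕ) :
    μ (frontier (disjointed U j)) = 0 := by
  refine disjointedRec (p := fun s => μ (frontier s) = 0) (fun t i ht => ?_) (hU j)
  refine measure_mono_null (t := frontier t ∪ frontier (U i)) ?_ (measure_union_null ht (hU i))
  rw [Set.sdiff_eq, ← frontier_compl (U i)]
  exact (frontier_inter_subset _ _).trans
    (Set.union_subset_union Set.inter_subset_left Set.inter_subset_right)

theorem IsCompact.exists_isOpen_null_frontier {X : Type*} [TopologicalSpace X]
    [TopologicalSpace.MetrizableSpace X] [MeasurableSpace X] [BorelSpace X] {μ : Measure X}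
    [IsFiniteMeasure μ] {L : Set X} (hL : IsCompact L) (h0 : μ L = 0) {η : ℝ} (hη : 0 < η) :
    ∃ U : Set X, IsOpen U ∧ L ⊆ U ∧ μ (frontier U) = 0 ∧ μ.real U < η := by
  let _ := TopologicalSpace.metrizableSpaceMetric X
  obtain ⟨r, hr, hr'⟩ := exists_null_frontiers_thickening μ L
  have hlim := tendsto_measure_thickening_of_isClosed (μ := μ)
    ⟨1, one_pos, MeasureTheory.measure_ne_top μ _⟩ hL.isClosed
  have hlim' := hlim.comp (tendsto_nhdsWithin_iff.2 ⟨hr, Eventually.of_forall fun n => (hr' n).1⟩)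
  rw [h0] at hlim'
  obtain ⟨n, hn⟩ := (hlim'.eventually_lt_const (ENNReal.ofReal_pos.2 hη)).exists
  exact ⟨_, Metric.isOpen_thickening, Metric.self_subset_thickening (hr' n).1 _, (hr' n).2,
    (ENNReal.lt_ofReal_iff_toReal_lt (MeasureTheory.measure_ne_top μ _)).1 hn⟩

theorem IsCompact.exists_isOpen_mul_div_mul_mem {H : Type*} [Group H] [TopologicalSpace H]
    [IsTopologicalGroup H] {L U : Set H} (hL : IsCompact L) (hU : IsOpen U) (hLU : L * L ⊆ U) :
    ∃ W : Set H, IsOpen W ∧ (1 : H) ∈ W ∧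
      ∀ k ∈ L, ∀ k' ∈ L, ∀ w ∈ W / W, k * w * k' ∈ U := by
  obtain ⟨A, B, -, hB, hA', hB', hAB⟩ := generalized_tube_lemma (hL.prod hL)
    (isCompact_singleton (x := (1 : H)))
    (n := (fun p : (H × H) × H => p.1.1 * p.2 * p.1.2) ⁻¹' U)
    (hU.preimage (by fun_prop)) (by
      rintro ⟨⟨k, k'⟩, w⟩ ⟨⟨hk, hk'⟩, rfl⟩
      simpa using hLU (Set.mul_mem_mul hk hk'))
  obtain ⟨V, hV, hVB⟩ := exists_nhds_split_inv (hB.mem_nhds (hB' rfl))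
  refine ⟨interior V, isOpen_interior, mem_interior_iff_mem_nhds.2 hV, ?_⟩
  rintro k hk k' hk' _ ⟨v, hv, w, hw, rfl⟩
  exact hAB (Set.mk_mem_prod (hA' (Set.mk_mem_prod hk hk'))
    (hVB v (interior_subset hv) w (interior_subset hw)))

/-! ### Recurrence for rotations of a compact group -/

/-- A set of measurable recurrence contains, outside any compact set, return times of a nonempty
open set `W` under the rotation of `H` through `ψ`. The action is carried to `ULift H`, which
lies in the universe over which recurrence quantifies. -/
theorem IsMeasurableRecurrenceSet.exists_mem_div {G : Type u} [Group G] [TopologicalSpace G]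
    [SecondCountableTopology G] [MeasurableSpace G] [OpensMeasurableSpace G] {R : Set G}
    (hR : IsMeasurableRecurrenceSet.{u, v} R)
    {H : Type} [Group H] [TopologicalSpace H] [IsTopologicalGroup H] [CompactSpace H]
    [SecondCountableTopology H] {ψ : G →* H} (hψ : Continuous ψ) {W : Set H} (hW : IsOpen W)
    (hne : W.Nonempty) {F : Set G} (hF : IsCompact F) :
    ∃ g ∈ R \ F, ψ g ∈ W / W := by
  borelize H
  let μ : Measure H := Measure.haarMeasure ⊤
  have : IsProbabilityMeasure μ := ⟨Measure.haarMeasure_self⟩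
  let act : MulAction G (ULift.{v} H) :=
    { smul := fun g x => ⟨ψ g * x.down⟩
      one_smul := fun x => ULift.ext _ _ (by change ψ 1 * x.down = _; simp)
      mul_smul := fun a b x => ULift.ext _ _ (by
        change ψ (a * b) * x.down = ψ a * (ψ b * x.down); simp [mul_assoc]) }
  have hsmul : ∀ (g : G) (x : ULift.{v} H), g • x = ⟨ψ g * x.down⟩ := fun _ _ => rfl
  let ν : Measure (ULift.{v} H) := μ.map ULift.up
  have hν : ∀ s : Set (ULift.{v} H), ν s = μ (ULift.up ⁻¹' s) := fun s =>
    (MeasurableEquiv.ulift.symm : H ≃ᵐ ULift.{v} H).map_apply s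
  have : IsProbabilityMeasure ν := Measure.isProbabilityMeasure_map measurable_up.aemeasurable
  have : MeasurableSpace.CountablyGenerated (ULift.{v} H) := by
    rw [← (MeasurableEquiv.ulift.{0, v} (α := H)).measurableEmbedding.comap_eq]
    exact .comap _
  have : MeasurableSMul₂ G (ULift.{v} H) := ⟨measurable_up.comp
    (((hψ.measurable.comp measurable_fst).mul (measurable_down.comp measurable_snd)))⟩
  have : SMulInvariantMeasure G (ULift.{v} H) ν := ⟨fun g s _ => by
    rw [hν, hν]
    exact measure_preimage_mul μ (ψ g) (ULift.up ⁻¹' s)⟩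
  obtain ⟨g, hg, hpos⟩ := hR F hF (ULift.{v} H) ν (ULift.down ⁻¹' W)
    (measurable_down hW.measurableSet) (by rw [hν]; exact (hW.measure_pos μ hne).ne')
  obtain ⟨x, hx, y, hy, rfl⟩ := nonempty_of_measure_ne_zero hpos.ne'
  exact ⟨g, hg, ⟨_, hx, _, hy, by simp [hsmul]⟩⟩

/-! ### The construction of the large set -/

/-- A compact subset of `G` has density zero, because its image in `H` is closed and null. -/
theorem hasDensity_isCompact_zero {G : Type u} [Group G] [TopologicalSpace G]
    [IsTopologicalGroup G] [T2Space G] [SigmaCompactSpace G] [MeasurableSpace G] [BorelSpace G]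
    {m : Measure G} [m.IsHaarMeasure] {Φ : ℕ → Set G} (hΦ : IsLeftFolner m Φ)
    {H : Type*} [Group H] [TopologicalSpace H] [IsTopologicalGroup H] [CompactSpace H] [T2Space H]
    [SecondCountableTopology H] {ψ : G →* H} (hψ : Continuous ψ) (hd : DenseRange ψ)
    (hker : ¬ CompactSpace (G ⧸ ψ.ker)) {F : Set G} (hF : IsCompact F) :
    HasDensity m Φ F 0 := by
  borelize H
  let μ : Measure H := Measure.haarMeasure ⊤
  have : IsProbabilityMeasure μ := ⟨Measure.haarMeasure_self⟩
  have h0 : μ (ψ '' F) = 0 := haar_image_eq_zero μ hψ hd hker hF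
  have hcl : IsClosed (ψ '' F) := (hF.image hψ).isClosed
  have h := hasDensity_preimage_of_null_frontier hΦ hψ hd μ hcl.measurableSet
    (measure_mono_null hcl.frontier_subset h0)
  rw [Measure.real, h0, ENNReal.toReal_zero] at h
  exact h.zero_of_subset hΦ.measure_ne_top (Set.subset_preimage_image _ _)

theorem mainTheorem2 {G : Type u} [Group G] [TopologicalSpace G] [IsTopologicalGroup G]
    [T2Space G] [LocallyCompactSpace G] [SecondCountableTopology G]
    [MeasurableSpace G] [BorelSpace G] (m : Measure G) [m.IsHaarMeasure]
    (hamen : IsAmenableGroup G m)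
    (hker : ¬ CompactSpace (G ⧸ vonNeumannKernel G))
    (Φ : ℕ → Set G) (hΦ : IsLeftFolner m Φ) (ε : ℝ) (hε : 0 < ε) :
    ∃ E : Set G, MeasurableSet E ∧ (∃ d : ℝ, HasDensity m Φ E d ∧ 1 - ε < d) ∧
      ∀ K : Set G, IsCompact K →
        ∀ R : Set G, IsMeasurableRecurrenceSet.{u, v} R → ¬ R ⊆ K * E * K := by
  obtain ⟨H, _, _, _, _, _, _, ψ, hψ, hd, hψker⟩ := exists_hom_compact_ker_eq_vonNeumannKernel G
  rw [← hψker] at hker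
  borelize H
  let μ : Measure H := Measure.haarMeasure ⊤
  have : IsProbabilityMeasure μ := ⟨Measure.haarMeasure_self⟩
  let L : CompactExhaustion G := default
  let η : ℕ → ℝ := fun j => ε / 2 / 2 / 2 ^ j
  have hη : ∀ j, 0 < η j := fun j => by positivity
  have hηsum : HasSum η (ε / 2) := hasSum_geometric_two' (ε / 2)
  have hLL : ∀ j, ψ '' L j * ψ '' L j = ψ '' (L j * L j) := fun j => (Set.image_mul ψ).symm
  have hU : ∀ j, ∃ U : Set H, IsOpen U ∧ ψ '' L j * ψ '' L j ⊆ U ∧ μ (frontier U) = 0 ∧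
      μ.real U < η j := fun j => by
    have hc : IsCompact (L j * L j) := (L.isCompact j).mul (L.isCompact j)
    rw [hLL]
    exact (hc.image hψ).exists_isOpen_null_frontier (haar_image_eq_zero μ hψ hd hker hc) (hη j)
  choose U hUo hLU hUf hUη using hU
  have hdensU : ∀ j, HasDensity m Φ (ψ ⁻¹' U j) (μ.real (U j)) := fun j =>
    hasDensity_preimage_of_null_frontier hΦ hψ hd μ (hUo j).measurableSet (hUf j)
  have hN : ∀ j, ∃ n, ∀ N, n ≤ N → m.real (ψ ⁻¹' U j ∩ Φ N) / m.real (Φ N) < η j := fun j =>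
    eventually_atTop.1 ((hdensU j).eventually_lt_const (hUη j))
  choose n hn using hN
  -- Removing `F j` leaves a set whose proportion is at most `η j` in every Følner set, not only in
  -- those of index at least `n j`.
  let F : ℕ → Set G := fun j => ⋃ N ∈ Finset.range (n j), Φ N
  have hF : ∀ j, IsCompact (F j) := fun j =>
    (Finset.range (n j)).isCompact_biUnion fun N _ => hΦ.isCompact N
  let D : ℕ → Set G := fun j => ψ ⁻¹' U j \ F j
  have hDm : ∀ j, MeasurableSet (D j) := fun j =>
    (hψ.measurable (hUo j).measurableSet).diff (hF j).isClosed.measurableSet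
  -- `disjointed D j` and `ψ ⁻¹' disjointed U j` differ within the compact set `⋃ i ≤ j, F i` only.
  have hdens : ∀ j, HasDensity m Φ (disjointed D j) (μ.real (disjointed U j)) := fun j => by
    have hc : IsCompact (⋃ i ∈ Finset.range (j + 1), F i) :=
      (Finset.range (j + 1)).isCompact_biUnion fun i _ => hF i
    refine (hasDensity_preimage_of_null_frontier hΦ hψ hd μ
      (MeasurableSet.disjointed (fun i => (hUo i).measurableSet) j)
      (measure_frontier_disjointed_eq_zero hUf j)).of_symmDiff_subset hΦ.measure_ne_top
      (hasDensity_isCompact_zero hΦ hψ hd hker hc) ?_ ?_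
    · intro x hx
      by_cases hxF : x ∈ F j
      · exact Or.inr (Set.mem_biUnion (Finset.mem_coe.2 (Finset.self_mem_range_succ j)) hxF)
      · rw [disjointed_eq_inter_compl] at hx
        rw [disjointed_eq_inter_compl]
        exact Or.inl ⟨⟨hx.1, hxF⟩, Set.mem_iInter₂.2 fun i hi hxi =>
          Set.mem_iInter₂.1 hx.2 i hi hxi.1⟩
    · intro x hx
      rw [disjointed_eq_inter_compl] at hx
      by_cases hxF : x ∈ ⋃ i ∈ Finset.range (j + 1), F i
      · exact Or.inr hxF
      · rw [Set.mem_union, Set.mem_preimage, disjointed_eq_inter_compl]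
        refine Or.inl ⟨hx.1.1, Set.mem_iInter₂.2 fun i hi hxi =>
          Set.mem_iInter₂.1 hx.2 i hi ⟨hxi, fun hxFi => hxF ?_⟩⟩
        exact Set.mem_biUnion (Finset.mem_coe.2 (Finset.mem_range.2 (Nat.lt_succ_of_lt hi))) hxFi
  have hbound : ∀ j N, m.real (disjointed D j ∩ Φ N) / m.real (Φ N) ≤ η j := fun j N => by
    rcases lt_or_ge N (n j) with h | h
    · have hempty : disjointed D j ∩ Φ N = ∅ := by
        refine Set.eq_empty_iff_forall_notMem.2 fun x hx => ?_
        exact (disjointed_subset D j hx.1).2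
          (Set.mem_biUnion (Finset.mem_coe.2 (Finset.mem_range.2 h)) hx.2)
      simpa [hempty] using (hη j).le
    · refine le_trans (div_le_div_of_nonneg_right (measureReal_mono ?_ ?_) measureReal_nonneg)
        (hn j N h).le
      · exact Set.inter_subset_inter_left _ ((disjointed_subset D j).trans Set.sdiff_subset)
      · exact measure_ne_top_of_subset Set.inter_subset_right (hΦ.measure_ne_top N)
  have hD := HasDensity.iUnion hΦ.measure_ne_top (MeasurableSet.disjointed hDm)
    (disjoint_disjointed D) hdens hbound hηsum.summable
  rw [iUnion_disjointed] at hD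
  have hle : ∀ j, μ.real (disjointed U j) ≤ η j := fun j =>
    (measureReal_mono (disjointed_subset U j)).trans (hUη j).le
  have htsum : ∑' j, μ.real (disjointed U j) ≤ ε / 2 :=
    ((Summable.of_nonneg_of_le (fun _ => measureReal_nonneg) hle hηsum.summable).tsum_le_tsum hle
      hηsum.summable).trans_eq hηsum.tsum_eq
  refine ⟨(⋃ j, D j)ᶜ, (MeasurableSet.iUnion hDm).compl,
    ⟨_, hD.compl hΦ.measureReal_pos (MeasurableSet.iUnion hDm), by linarith⟩, ?_⟩
  intro K hK R hR hRK
  obtain ⟨j, hj⟩ := L.exists_superset_of_isCompact hK.inv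
  obtain ⟨W, hWo, hW1, hW⟩ :=
    ((L.isCompact j).image hψ).exists_isOpen_mul_div_mul_mem (hUo j) (hLU j)
  obtain ⟨g, ⟨hgR, hgF⟩, hgW⟩ :=
    hR.exists_mem_div hψ hWo ⟨1, hW1⟩ ((hK.mul (hF j)).mul hK)
  -- For `g = k * e * k'` the point `ψ e = (ψ k)⁻¹ * ψ g * (ψ k')⁻¹` lies in `U j`, while `e ∉ F j`.
  obtain ⟨_, ⟨k, hk, e, he, rfl⟩, k', hk', rfl⟩ := hRK hgR
  refine he (Set.mem_iUnion.2 ⟨j, ?_, fun heF =>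
    hgF (Set.mul_mem_mul (Set.mul_mem_mul hk heF) hk')⟩)
  have := hW _ ⟨k⁻¹, hj (Set.inv_mem_inv.2 hk), rfl⟩ _ ⟨k'⁻¹, hj (Set.inv_mem_inv.2 hk'), rfl⟩ _ hgW
  simpa [mul_assoc] using this
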